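/- **Setting.** Let $G=\langle I,(S_i,\pi_i)_{i\in I}\rangle$ be a finite game: $I$ is finite with $|I|\ge 2$, each $S_i$ is finite, non-empty and discrete, and $\pi_i:\prod_{j\in I} S_j\to\mathbb R$. Write $A_{-i}=\prod_{j\ne i}A_j$. A Souslin space is a continuous image of a complete separable metric space. For a topological space $X$, $\mathcal M(X)$ is the set of Borel probability measures on $X$ with the weak* topology (the coarsest one making $\mu\mapsto\mu(U)$ lower semicontinuous for all open $U$), and $\mathcal N(X)=\bigcup_{n\ge1}\mathcal M(X)^n$, with the direct sum topology, is the set of lexicographic probability systems $(\mu^1,\dots,\mu^n)$. For a Borel map $f:X\to Y$, $\widehat f:\mathcal N(X)\to\mathcal N(Y)$ is $(\mu^l)_{l\le n}\mapsto(\mu^l\circ f^{-1})_{l\le n}$. A type structure $\mathcal T=\langle S_i,T_i,\beta_i\rangle_{i\in I}$ consists of Souslin spaces $T_i$ and Borel maps $\beta_i:T_i\to\mathcal N(S_{-i}\times T_{-i})$. **Hierarchies.** Put $X_i^1=S_{-i}$ and $X_i^{m+1}=X_i^m\times\prod_{j\ne i}\mathcal N(X_j^m)$. Let $\rho_{-i}^1:S_{-i}\times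 T_{-i}\to X_i^1$ be the projection, and recursively $d_i^m=\widehat\rho_{-i}^{\,m}\circ\beta_i:T_i\to\mathcal N(X_i^m)$ (the $m$-th order belief of a type) and $\rho_{-i}^{m+1}=(\rho_{-i}^m,(d_j^m)_{j\neq i}):S_{-i}\times T_{-i}\to X_i^{m+1}$. **Events.** Let $\beta_i(t_i)=(\mu^1,\dots,\mu^n)$. The pair $(s_i,t_i)$ is cautiously rational if $s_i$ maximizes lexicographically the vector $\big(\pi_i(\cdot,\mathrm{marg}_{S_{-i}}\mu^l)\big)_{l\le n}$ of expected payoffs over $S_i$, and $\bigcup_{l\le n}\mathrm{Supp}\,\mathrm{marg}_{S_{-i}}\mu^l=S_{-i}$. The type $t_i$ cautiously believes $E\subseteq S_{-i}\times T_{-i}$ if for some $1\le k\le n$: $\mu^l(E)=1$ for all $l\le k$, and for every $s_{-i}\in S_{-i}$ with $E\cap(\{s_{-i}\}\times T_{-i})\ne\emptyset$ there is $l\le k$ with $\mu^l\big(E\cap(\{s_{-i}\}\times T_{-i})\big)>0$. Let $R_i^0=S_i\times T_i$, let $R_i^1$ be the set of cautiously rational pairs, and for $m\ge1$ let $R_i^{m+1}=\{(s_i,t_i)\in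 R_i^m: t_i\text{ cautiously believes }\prod_{j\ne i}R_j^m\}$. **Lemma 2.** Let $\mathcal T$ and $\mathcal T^\circ$ be two type structures for the same finite game $G$; the objects of $\mathcal T^\circ$ carry the superscript $\circ$. Let $m\ge1$, $i\in I$, $t_i\in T_i$ and $t_i^\circ\in T_i^\circ$ be such that (a) $d_i^m(t_i)=d_i^{\circ,m}(t_i^\circ)$, and (b) $\mathrm{Proj}_{S_j}(R_j^{k-1})=\mathrm{Proj}_{S_j}(R_j^{\circ,k-1})$ for every player $j\in I$ and every level $1\le k\le m$. Then, for every $s_i\in S_i$, $(s_i,t_i)\in R_i^m$ implies $(s_i,t_i^\circ)\in R_i^{\circ,m}$. -/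

import Mathlib

open MeasureTheory Set
open scoped ENNReal

universe u v w w'

/-! ### Borel probability measures and lexicographic probability systems -/

/-- `f` is Borel measurable: measurable for the Borel `σ`-algebras of the two topologies. -/
def BorelMap {X : Type*} {Y : Type*} [TopologicalSpace X] [TopologicalSpace Y]
    (f : X → Y) : Prop :=
  Measurable[borel X, borel Y] f

/-- `M(X)`: the Borel probability measures on the topological space `X`. -/
def BorelProb (X : Type u) [TopologicalSpace X] : Type u :=
  {μ : @Measure X (borel X) // @IsProbabilityMeasure X (borel X) μ}

/-- The weak* (narrow) topology on `M(X)`, for an arbitrary topological space `X`: the coarsest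
topology for which `μ ↦ μ U` is lower semicontinuous for every open `U ⊆ X`.  On a separable
metrizable space it is the topology of convergence of the integrals of bounded continuous
functions (`BorelProb.isInducing_toProbabilityMeasure`).  On every space, it makes `μ ↦ μ E` Borel
for each Borel set `E` (`BorelProb.measurable_apply`). -/
instance BorelProb.instTopologicalSpace (X : Type u) [TopologicalSpace X] :
    TopologicalSpace (BorelProb X) :=
  TopologicalSpace.generateFrom
    {W | ∃ U : Set X, IsOpen U ∧ ∃ r : ℝ≥0∞, W = {μ : BorelProb X | r < μ.1 U}}

/-- The image measure `μ ∘ f⁻¹`. -/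
noncomputable def BorelProb.image {X : Type*} {Y : Type*} [TopologicalSpace X]
    [TopologicalSpace Y] (f : X → Y) (hf : BorelMap f) (μ : BorelProb X) : BorelProb Y :=
  ⟨@Measure.map X Y (borel X) (borel Y) f μ.1, by
    let := borel X
    let := borel Y
    have := μ.2
    exact Measure.isProbabilityMeasure_map (Measurable.aemeasurable hf)⟩

/-- `N(X)`: the lexicographic probability systems on `X`, that is, the sequences
`(μ¹, …, μⁿ)`, `n ≥ 1`, of Borel probability measures on `X`.  The first component stores
`n - 1`.  The topology is the direct sum over `n` of the product topologies. -/
abbrev LPS (X : Type u) [TopologicalSpace X] : Type u :=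
  Σ n : ℕ, (Fin (n + 1) → BorelProb X)

/-- The image LPS map `f̂ : N(X) → N(Y)` of a Borel map `f : X → Y`. -/
noncomputable def LPS.image {X : Type*} {Y : Type*} [TopologicalSpace X]
    [TopologicalSpace Y] (f : X → Y) (hf : BorelMap f) (ν : LPS X) : LPS Y :=
  ⟨ν.1, fun l => (ν.2 l).image f hf⟩

/-- `Supp μ = ⋃ₗ Supp μˡ`. -/
def LPS.support {X : Type*} [TopologicalSpace X] (ν : LPS X) : Set X :=
  ⋃ l, @Measure.support X _ (borel X) (ν.2 l).1

/-- A full-support LPS. -/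
def LPS.FullSupport {X : Type*} [TopologicalSpace X] (ν : LPS X) : Prop :=
  ν.support = univ

/-! Borel measurability of the maps that enter the definition of belief hierarchies. -/

theorem Continuous.borelMap {X : Type*} {Y : Type*} [TopologicalSpace X] [TopologicalSpace Y]
    {f : X → Y} (hf : Continuous f) : BorelMap f := by
  let := borel X
  let := borel Y
  have : BorelSpace X := ⟨rfl⟩
  have : BorelSpace Y := ⟨rfl⟩
  exact hf.measurable

theorem BorelMap.comp {X : Type*} {Y : Type*} {Z : Type*} [TopologicalSpace X]
    [TopologicalSpace Y] [TopologicalSpace Z] {g : Y → Z} {f : X → Y} (hg : BorelMap g)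
    (hf : BorelMap f) : BorelMap (fun x => g (f x)) :=
  @Measurable.comp X Y Z (borel X) (borel Y) (borel Z) g f hg hf

theorem BorelMap.prodMk {X : Type*} {Y : Type*} {Z : Type*} [TopologicalSpace X]
    [TopologicalSpace Y] [TopologicalSpace Z] [SecondCountableTopology Y]
    [SecondCountableTopology Z] {f : X → Y} {g : X → Z} (hf : BorelMap f) (hg : BorelMap g) :
    BorelMap (fun x => (f x, g x)) := by
  let := borel X
  let := borel Y
  let := borel Z
  have : BorelSpace Y := ⟨rfl⟩
  have : BorelSpace Z := ⟨rfl⟩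
  have h : Measurable (fun x => (f x, g x)) := Measurable.prodMk hf hg
  unfold BorelMap
  rw [← BorelSpace.measurable_eq (α := Y × Z)]
  exact h

theorem BorelMap.pi {X : Type*} {ι : Type*} [Countable ι] {Y : ι → Type*} [TopologicalSpace X]
    [∀ j, TopologicalSpace (Y j)] [∀ j, SecondCountableTopology (Y j)] {f : ∀ j, X → Y j}
    (hf : ∀ j, BorelMap (f j)) : BorelMap (fun x j => f j x) := by
  let := borel X
  let : ∀ j, MeasurableSpace (Y j) := fun j => borel (Y j)
  have : ∀ j, BorelSpace (Y j) := fun j => ⟨rfl⟩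
  have h : Measurable (fun x j => f j x) := measurable_pi_lambda _ fun j => hf j
  unfold BorelMap
  rw [← BorelSpace.measurable_eq (α := ∀ j, Y j)]
  exact h

/-- Evaluation at a Borel set is a Borel function on `M(X)`. -/
theorem BorelProb.measurable_apply {X : Type*} [TopologicalSpace X] {E : Set X}
    (hE : MeasurableSet[borel X] E) :
    Measurable[borel (BorelProb X), inferInstance] (fun μ : BorelProb X => μ.1 E) := by
  let := borel X
  have : BorelSpace X := ⟨rfl⟩
  let := borel (BorelProb X)
  have : BorelSpace (BorelProb X) := ⟨rfl⟩
  have : ∀ μ : BorelProb X, IsProbabilityMeasure (μ.1 : Measure X) := fun μ => μ.2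
  have key : Measurable (fun μ : BorelProb X => (μ.1 : Measure X)) := by
    refine Measurable.measure_of_isPiSystem_of_isProbabilityMeasure
      (S := {U : Set X | IsOpen U}) rfl isPiSystem_isOpen ?_
    intro U hU
    refine measurable_of_Ioi fun r => IsOpen.measurableSet ?_
    exact TopologicalSpace.isOpen_generateFrom_of_mem ⟨U, hU, r, rfl⟩
  exact Measure.measurable_coe hE |>.comp key

/-- If `X` is second countable, so is `M(X)`. -/
instance BorelProb.instSecondCountableTopology (X : Type u) [TopologicalSpace X]
    [SecondCountableTopology X] : SecondCountableTopology (BorelProb X) := by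
  let := borel X
  have : BorelSpace X := ⟨rfl⟩
  let F : Set (Set (Set X)) := {s | s.Finite ∧ s ⊆ TopologicalSpace.countableBasis X}
  have hF : F.Countable :=
    Set.countable_ofPred_finite_subset (TopologicalSpace.countable_countableBasis X)
  let g : Set (Set X) × ℚ → Set (BorelProb X) :=
    fun p => {μ | ((Real.toNNReal p.2 : NNReal) : ℝ≥0∞) < μ.1 (⋃₀ p.1)}
  refine ⟨⟨g '' (F ×ˢ univ), (hF.prod countable_univ).image g, le_antisymm ?_ ?_⟩⟩
  · refine le_generateFrom ?_
    rintro _ ⟨⟨s, q⟩, ⟨hs, -⟩, rfl⟩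
    refine TopologicalSpace.isOpen_generateFrom_of_mem ⟨⋃₀ s, ?_, _, rfl⟩
    exact isOpen_sUnion fun V hV => TopologicalSpace.isOpen_of_mem_countableBasis (hs.2 hV)
  · refine le_generateFrom ?_
    rintro _ ⟨U, hU, r, rfl⟩
    let S : Set (Set X) := {V | V ∈ TopologicalSpace.countableBasis X ∧ V ⊆ U}
    have hS : S.Countable :=
      (TopologicalSpace.countable_countableBasis X).mono fun V hV => hV.1
    have : Countable S := hS.to_subtype
    have hUS : U = ⋃ t : Finset S, ⋃ V ∈ t, (V : Set X) := by
      ext x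
      simp only [mem_iUnion]
      constructor
      · intro hx
        obtain ⟨V, hV, hxV, hVU⟩ :=
          (TopologicalSpace.isBasis_countableBasis X).exists_subset_of_mem_open hx hU
        exact ⟨{⟨V, hV, hVU⟩}, ⟨V, hV, hVU⟩, by simp, hxV⟩
      · rintro ⟨t, V, -, hx⟩
        exact V.2.2 hx
    have hdir : Directed (· ⊆ ·) fun t : Finset S => ⋃ V ∈ t, (V : Set X) := by
      classical
      intro t t'
      exact ⟨t ∪ t', biUnion_subset_biUnion_left fun V hV => Finset.mem_union_left _ hV,
        biUnion_subset_biUnion_left fun V hV => Finset.mem_union_right _ hV⟩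
    have hW : {μ : BorelProb X | r < μ.1 U} =
        ⋃₀ {W | W ∈ g '' (F ×ˢ univ) ∧ W ⊆ {μ : BorelProb X | r < μ.1 U}} := by
      refine Subset.antisymm ?_ (sUnion_subset fun W hW => hW.2)
      intro μ hμ
      have h1 : r < ⨆ t : Finset S, μ.1 (⋃ V ∈ t, (V : Set X)) := by
        rw [← hdir.measure_iUnion, ← hUS]
        exact hμ
      obtain ⟨t, ht⟩ := lt_iSup_iff.1 h1
      obtain ⟨q, -, hq1, hq2⟩ := ENNReal.lt_iff_exists_rat_btwn.1 ht
      have ht' : ⋃₀ (Subtype.val '' (t : Set S)) = ⋃ V ∈ t, (V : Set X) := by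
        simp [sUnion_image]
      refine ⟨g (Subtype.val '' (t : Set S), q), ⟨⟨_, ⟨⟨t.finite_toSet.image _, ?_⟩, trivial⟩,
        rfl⟩, ?_⟩, ?_⟩
      · rintro _ ⟨V, -, rfl⟩
        exact V.2.1
      · intro ν hν
        have hν' : ((Real.toNNReal q : NNReal) : ℝ≥0∞) <
            ν.1 (⋃₀ (Subtype.val '' (t : Set S))) := hν
        refine hq1.trans (hν'.trans_le (measure_mono ?_))
        rintro x ⟨_, ⟨V, -, rfl⟩, hx⟩
        exact V.2.2 hx
      · change ((Real.toNNReal q : NNReal) : ℝ≥0∞) < μ.1 (⋃₀ (Subtype.val '' (t : Set S)))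
        rw [ht']
        exact hq2
    rw [hW]
    refine @isOpen_sUnion _ (TopologicalSpace.generateFrom _) _ fun W hW => ?_
    exact TopologicalSpace.isOpen_generateFrom_of_mem hW.1

/-- The map `μ ↦ μ ∘ f⁻¹` is Borel. -/
theorem BorelProb.borelMap_image {X : Type*} {Y : Type*} [TopologicalSpace X]
    [TopologicalSpace Y] [SecondCountableTopology Y] (f : X → Y) (hf : BorelMap f) :
    BorelMap (BorelProb.image f hf) := by
  unfold BorelMap
  rw [borel_eq_generateFrom_of_subbasis (α := BorelProb Y) rfl]
  refine @measurable_generateFrom _ _ (borel _) _ _ ?_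
  rintro _ ⟨U, hU, r, rfl⟩
  have hUm : MeasurableSet[borel Y] U := MeasurableSpace.measurableSet_generateFrom hU
  have h1 : BorelProb.image f hf ⁻¹' {μ : BorelProb Y | r < μ.1 U} =
      (fun μ : BorelProb X => μ.1 (f ⁻¹' U)) ⁻¹' Ioi r := by
    ext μ
    change r < @Measure.map X Y (borel X) (borel Y) f μ.1 U ↔ r < μ.1 (f ⁻¹' U)
    rw [@Measure.map_apply X Y (borel X) (borel Y) μ.1 f hf U hUm]
  rw [h1]
  exact BorelProb.measurable_apply (hf hUm) measurableSet_Ioi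

/-- The image LPS map of a Borel map is Borel. -/
theorem LPS.borelMap_image {X : Type*} {Y : Type*} [TopologicalSpace X]
    [TopologicalSpace Y] [SecondCountableTopology Y] (f : X → Y) (hf : BorelMap f) :
    BorelMap (LPS.image f hf) := by
  refine @measurable_generateFrom _ _ (borel _) _ _ fun W hW => ?_
  have h1 : ∀ n : ℕ, BorelMap (fun ν : Fin (n + 1) → BorelProb X =>
      (LPS.image f hf ⟨n, ν⟩ : LPS Y)) := by
    intro n
    refine BorelMap.comp (g := fun ν => (⟨n, ν⟩ : LPS Y)) continuous_sigmaMk.borelMap ?_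
    exact BorelMap.pi (f := fun l (ν : Fin (n + 1) → BorelProb X) => (ν l).image f hf) fun l =>
      (BorelProb.borelMap_image f hf).comp (continuous_apply l).borelMap
  have h2 : LPS.image f hf ⁻¹' W = ⋃ n : ℕ, Sigma.mk n ''
      ((fun ν : Fin (n + 1) → BorelProb X => (LPS.image f hf ⟨n, ν⟩ : LPS Y)) ⁻¹' W) := by
    ext ⟨n, ν⟩
    simp only [mem_iUnion]
    constructor
    · exact fun h => ⟨n, ν, h, rfl⟩
    · rintro ⟨n', ν', h, h'⟩
      rw [← h']
      exact h
  rw [h2]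
  refine @MeasurableSet.iUnion _ _ (borel _) _ _ fun n => ?_
  let := borel (Fin (n + 1) → BorelProb X)
  have : BorelSpace (Fin (n + 1) → BorelProb X) := ⟨rfl⟩
  let := borel (LPS X)
  have : BorelSpace (LPS X) := ⟨rfl⟩
  exact Topology.IsOpenEmbedding.sigmaMk.measurableEmbedding.measurableSet_image.2
    (h1 n (MeasurableSpace.measurableSet_generateFrom hW))

/-- Consistency check: on a separable metrizable space, the topology of `M(X)` defined above is the
usual one, induced by the integrals of bounded continuous functions. -/
theorem BorelProb.isInducing_toProbabilityMeasure (X : Type u) [TopologicalSpace X]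
    [TopologicalSpace.PseudoMetrizableSpace X] [SecondCountableTopology X] :
    let _ : MeasurableSpace X := borel X
    have _ : BorelSpace X := ⟨rfl⟩
    Topology.IsInducing (X := BorelProb X) (Y := ProbabilityMeasure X) fun μ => ⟨μ.1, μ.2⟩ := by
  intro _ _
  let c : BorelProb X → ProbabilityMeasure X := fun μ => ⟨μ.1, μ.2⟩
  change Topology.IsInducing c
  refine ⟨le_antisymm (continuous_iff_le_induced.1 (continuous_iff_continuousAt.2 fun μ => ?_))
    (le_generateFrom ?_)⟩
  · refine tendsto_of_forall_isOpen_le_liminf' fun G hG => ?_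
    refine le_of_forall_lt fun r hr => ?_
    obtain ⟨q, hq, hq'⟩ := exists_between hr
    refine hq.trans_le (Filter.le_liminf_of_le (by isBoundedDefault) ?_)
    have h : IsOpen {ν : BorelProb X | q < ν.1 G} :=
      TopologicalSpace.isOpen_generateFrom_of_mem ⟨G, hG, q, rfl⟩
    filter_upwards [h.mem_nhds hq'] with ν hν using le_of_lt hν
  · rintro _ ⟨U, hU, r, rfl⟩
    refine isOpen_induced_iff.2 ⟨{ν : ProbabilityMeasure X | r < (ν : Measure X) U}, ?_, rfl⟩
    refine isOpen_iff_mem_nhds.2 fun μ hμ => ?_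
    have h := ProbabilityMeasure.le_liminf_measure_open_of_tendsto (μ := μ) (μs := id)
      Filter.tendsto_id hU
    exact Filter.eventually_lt_of_lt_liminf (lt_of_lt_of_le hμ h)

/-! ### Finite games and type structures -/

/-- A finite game with player set `I`: each player `i` has a finite, non-empty strategy set
`S i` and a payoff function on strategy profiles. -/
structure FiniteGame (I : Type u) where
  /-- The strategy sets. -/
  S : I → Type v
  [finite : ∀ i, Finite (S i)]
  [nonempty : ∀ i, Nonempty (S i)]
  /-- The payoff functions. -/
  payoff : ∀ _ : I, (∀ j, S j) → ℝ

attribute [instance] FiniteGame.finite FiniteGame.nonempty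

/-- Strategy sets carry the discrete topology. -/
instance FiniteGame.instTopologicalSpace {I : Type u} (G : FiniteGame.{u, v} I) (i : I) :
    TopologicalSpace (G.S i) := ⊥

instance FiniteGame.instDiscreteTopology {I : Type u} (G : FiniteGame.{u, v} I) (i : I) :
    DiscreteTopology (G.S i) := ⟨rfl⟩

/-- `A₋ᵢ = ∏_{j ≠ i} Aⱼ`. -/
abbrev Others {I : Type u} (A : I → Type v) (i : I) : Type (max u v) :=
  ∀ j : {j : I // j ≠ i}, A j

/-- A Souslin space: the image of a Polish space under a continuous surjection. -/
def IsSouslinSpace (X : Type*) [TopologicalSpace X] : Prop :=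
  ∃ (Z : Type) (_ : TopologicalSpace Z) (_ : PolishSpace Z) (f : Z → X),
    Continuous f ∧ Function.Surjective f

/-- A lexicographic type structure for the game `G`: each type space `T i` is a Souslin space and
each belief map `β i : T i → N(S₋ᵢ × T₋ᵢ)` is Borel measurable. -/
structure TypeStructure {I : Type u} (G : FiniteGame.{u, v} I) where
  /-- The type spaces. -/
  T : I → Type w
  [top : ∀ i, TopologicalSpace (T i)]
  souslin : ∀ i, IsSouslinSpace (T i)
  /-- The belief maps. -/
  β : ∀ i, T i → LPS (Others G.S i × Others T i)
  borel_β : ∀ i, BorelMap (β i)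

attribute [instance] TypeStructure.top

/-! ### Hierarchies of beliefs -/

/-- The spaces of the belief hierarchies: `hierarchySpace G n i` is `Xᵢⁿ⁺¹`, where
`Xᵢ¹ = S₋ᵢ` and `Xᵢᵐ⁺¹ = Xᵢᵐ × ∏_{j ≠ i} N(Xⱼᵐ)`. -/
def hierarchySpace {I : Type u} (G : FiniteGame.{u, v} I) : ℕ → I → TopCat.{max u v}
  | 0, i => TopCat.of (Others G.S i)
  | n + 1, i => TopCat.of
      (hierarchySpace G n i × ∀ j : {j : I // j ≠ i}, LPS (hierarchySpace G n j))

instance hierarchySpace.instSecondCountableTopology {I : Type u} [Finite I]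
    (G : FiniteGame.{u, v} I) (n : ℕ) (i : I) :
    SecondCountableTopology (hierarchySpace G n i) := by
  induction n generalizing i with
  | zero => exact inferInstanceAs (SecondCountableTopology (Others G.S i))
  | succ n ih =>
    exact inferInstanceAs (SecondCountableTopology
      (hierarchySpace G n i × ∀ j : {j : I // j ≠ i}, LPS (hierarchySpace G n j)))

namespace TypeStructure

variable {I : Type u} {G : FiniteGame.{u, v} I}

/-- The maps `ρ₋ᵢ`, with their Borel measurability: `𝒯.rho n i` is
`ρ₋ᵢⁿ⁺¹ : S₋ᵢ × T₋ᵢ → Xᵢⁿ⁺¹`, where `ρ₋ᵢ¹` is the projection to `S₋ᵢ` and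
`ρ₋ᵢᵐ⁺¹ = (ρ₋ᵢᵐ, (dⱼᵐ)_{j ≠ i})` with `dⱼᵐ` the image of `βⱼ` under `ρ₋ⱼᵐ`. -/
noncomputable def rho [Finite I] (𝒯 : TypeStructure.{u, v, w} G) : ∀ (n : ℕ) (i : I),
    {f : Others G.S i × Others 𝒯.T i → hierarchySpace G n i // BorelMap f}
  | 0, i => ⟨Prod.fst, continuous_fst.borelMap⟩
  | n + 1, i => ⟨fun x => ((𝒯.rho n i).1 x,
        fun j => (𝒯.β j (x.2 j)).image (𝒯.rho n j).1 (𝒯.rho n j).2), by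
      refine BorelMap.prodMk (𝒯.rho n i).2 (BorelMap.pi fun j => ?_)
      refine (LPS.borelMap_image (𝒯.rho n j).1 (𝒯.rho n j).2).comp ((𝒯.borel_β j).comp ?_)
      exact ((continuous_apply j).comp continuous_snd).borelMap⟩

/-- The hierarchy maps: `𝒯.hierarchy n i t` is the belief of order `n + 1` of the type `t`, that
is `dᵢⁿ⁺¹(t) ∈ N(Xᵢⁿ⁺¹)`, the image of the LPS `βᵢ(t)` under `ρ₋ᵢⁿ⁺¹`. -/
noncomputable def hierarchy [Finite I] (𝒯 : TypeStructure.{u, v, w} G) (n : ℕ) (i : I)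
    (t : 𝒯.T i) : LPS (hierarchySpace G n i) :=
  (𝒯.β i t).image (𝒯.rho n i).1 (𝒯.rho n i).2

/-! ### Cautious rationality and cautious belief -/

/-- The marginal on `S₋ᵢ` of the LPS `βᵢ(t)`. -/
noncomputable def margS (𝒯 : TypeStructure.{u, v, w} G) (i : I) (t : 𝒯.T i) :
    LPS (Others G.S i) :=
  (𝒯.β i t).image Prod.fst continuous_fst.borelMap

end TypeStructure

/-- The expected payoff `πᵢ(s, μ) = ∑_{s₋ᵢ} πᵢ(s, s₋ᵢ) μ(s₋ᵢ)`. -/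
noncomputable def FiniteGame.expectedPayoff {I : Type u} [DecidableEq I]
    (G : FiniteGame.{u, v} I) (i : I) (s : G.S i) (μ : BorelProb (Others G.S i)) : ℝ :=
  ∑ᶠ s' : Others G.S i, G.payoff i ((Equiv.piSplitAt i G.S).symm (s, s')) * (μ.1 {s'}).toReal

/-- `x ≥_L y` for the lexicographic order. -/
def LexGE {n : ℕ} (x y : Fin n → ℝ) : Prop :=
  (∀ l, x l = y l) ∨ ∃ m, y m < x m ∧ ∀ l < m, x l = y l

namespace TypeStructure

variable {I : Type u} {G : FiniteGame.{u, v} I}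

/-- The strategy `s` is optimal under `βᵢ(t)`. -/
def Optimal [DecidableEq I] (𝒯 : TypeStructure.{u, v, w} G) (i : I) (s : G.S i)
    (t : 𝒯.T i) : Prop :=
  ∀ s' : G.S i, LexGE (fun l => G.expectedPayoff i s ((𝒯.margS i t).2 l))
    (fun l => G.expectedPayoff i s' ((𝒯.margS i t).2 l))

/-- The type `t` is cautious: its marginal LPS on `S₋ᵢ` has full support. -/
def Cautious (𝒯 : TypeStructure.{u, v, w} G) (i : I) (t : 𝒯.T i) : Prop :=
  (𝒯.margS i t).FullSupport

/-- The type `t` cautiously believes `E ⊆ S₋ᵢ × T₋ᵢ`: with `βᵢ(t) = (μ¹, …, μⁿ)`, there is a level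
`1 ≤ k ≤ n` such that `μˡ(E) = 1` for all `l ≤ k`, and every cylinder `{s₋ᵢ} × T₋ᵢ` that meets `E`
has an intersection with `E` of positive `μˡ`-measure for some `l ≤ k`.  (No type cautiously
believes the empty set.) -/
def CautiouslyBelieves (𝒯 : TypeStructure.{u, v, w} G) (i : I) (t : 𝒯.T i)
    (E : Set (Others G.S i × Others 𝒯.T i)) : Prop :=
  ∃ k : Fin ((𝒯.β i t).1 + 1),
    (∀ l ≤ k, ((𝒯.β i t).2 l).1 E = 1) ∧
    ∀ s' : Others G.S i, (E ∩ {s'} ×ˢ univ).Nonempty →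
      ∃ l ≤ k, 0 < ((𝒯.β i t).2 l).1 (E ∩ {s'} ×ˢ univ)

/-- The sets `Rᵢᵐ`: `Rᵢ⁰ = Sᵢ × Tᵢ`, `Rᵢ¹` is the set of cautiously rational strategy-type pairs,
and `Rᵢᵐ⁺¹ = Rᵢᵐ ∩ Bᵢᶜ(R₋ᵢᵐ)` for `m ≥ 1`, where `R₋ᵢᵐ = ∏_{j ≠ i} Rⱼᵐ`. -/
def R [DecidableEq I] (𝒯 : TypeStructure.{u, v, w} G) : ℕ → ∀ i : I, Set (G.S i × 𝒯.T i)
  | 0, _ => univ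
  | 1, i => {p | 𝒯.Optimal i p.1 p.2 ∧ 𝒯.Cautious i p.2}
  | m + 2, i => {p | p ∈ 𝒯.R (m + 1) i ∧ 𝒯.CautiouslyBelieves i p.2
      {q | ∀ j : {j : I // j ≠ i}, (q.1 j, q.2 j) ∈ 𝒯.R (m + 1) j}}

end TypeStructure

/-! For a fixed strategy, whether a type belongs to the level-`m` set depends only on its `m`-th
order belief, through a Borel condition that is common to the two structures once their lower-level
strategy projections agree. Equal beliefs then give equal membership.

The condition is built by induction. Cautious rationality concerns the marginal on `S₋ᵢ`, which is
the first-order belief. At the next level, the event that the opponents lie in `R` is the preimage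
under `rho` of a Borel set of hierarchies, so the measures of this event and of its slices are read
off from the image belief. Which slices are nonempty is not encoded in the belief; since the event
is a product, the strategy projections decide it, and they coincide by assumption.

Borel measurability has to be carried through the induction, because the image measure of a set is
the measure of its preimage for Borel sets. The induction is `exists_measurableSet_mem_R_iff`, with
`mem_R_add_two` as its step. -/

theorem LPS.measurableSet_of_preimage_mk {X : Type*} [TopologicalSpace X] {W : Set (LPS X)}
    (h : ∀ n : ℕ, MeasurableSet[borel (Fin (n + 1) → BorelProb X)] ((fun ν => (⟨n, ν⟩ : LPS X)) ⁻¹' W)) :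
    MeasurableSet[borel (LPS X)] W := by
  have h2 : W = ⋃ n : ℕ, Sigma.mk n '' (Sigma.mk n ⁻¹' W) := by
    ext ⟨n, ν⟩
    simp only [mem_iUnion]
    constructor
    · exact fun h => ⟨n, ν, h, rfl⟩
    · rintro ⟨n', ν', h, h'⟩
      rw [← h']
      exact h
  rw [h2]
  refine @MeasurableSet.iUnion _ _ (borel _) _ _ fun n => ?_
  let := borel (Fin (n + 1) → BorelProb X)
  have : BorelSpace (Fin (n + 1) → BorelProb X) := ⟨rfl⟩
  let := borel (LPS X)
  have : BorelSpace (LPS X) := ⟨rfl⟩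
  exact Topology.IsOpenEmbedding.sigmaMk.measurableEmbedding.measurableSet_image.2 (h n)

theorem BorelProb.measurable_eval_apply {X : Type*} [TopologicalSpace X] {n : ℕ} (l : Fin n)
    {E : Set X} (hE : MeasurableSet[borel X] E) :
    Measurable[borel (Fin n → BorelProb X), inferInstance]
      (fun ν : Fin n → BorelProb X => (ν l).1 E) :=
  @Measurable.comp _ _ _ (borel _) (borel _) _ _ _ (BorelProb.measurable_apply hE)
    (continuous_apply l).borelMap

theorem BorelProb.image_apply {X Y : Type*} [TopologicalSpace X] [TopologicalSpace Y]
    {f : X → Y} (hf : BorelMap f) (μ : BorelProb X) {E : Set Y} (hE : MeasurableSet[borel Y] E) :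
    (μ.image f hf).1 E = μ.1 (f ⁻¹' E) :=
  @Measure.map_apply X Y (borel X) (borel Y) μ.1 f hf E hE

theorem LPS.image_image {X Y Z : Type*} [TopologicalSpace X] [TopologicalSpace Y]
    [TopologicalSpace Z] {g : Y → Z} {f : X → Y} (hg : BorelMap g) (hf : BorelMap f) (ν : LPS X) :
    (ν.image f hf).image g hg = ν.image (fun x => g (f x)) (hg.comp hf) := by
  refine Sigma.ext rfl (heq_of_eq (funext fun l => Subtype.ext ?_))
  exact @Measure.map_map X Y Z (borel X) (borel Y) (borel Z) (ν.2 l).1 g f hg hf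

/-- The LPS's that, up to some level, assign probability one to `F` and give positive probability
to each `D c`, `c ∈ C`. -/
def LPS.cautiousBelief {X : Type*} [TopologicalSpace X] {ι : Type*} (F : Set X) (D : ι → Set X)
    (C : Set ι) : Set (LPS X) :=
  {ν | ∃ k : Fin (ν.1 + 1), (∀ l ≤ k, (ν.2 l).1 F = 1) ∧
    ∀ c, c ∈ C → ∃ l ≤ k, 0 < (ν.2 l).1 (D c)}

theorem LPS.measurableSet_cautiousBelief {X : Type*} [TopologicalSpace X] {ι : Type*} [Finite ι]
    {F : Set X} {D : ι → Set X} (C : Set ι) (hF : MeasurableSet[borel X] F)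
    (hD : ∀ c, MeasurableSet[borel X] (D c)) :
    MeasurableSet[borel (LPS X)] (LPS.cautiousBelief F D C) := by
  refine LPS.measurableSet_of_preimage_mk fun n => ?_
  let := borel (Fin (n + 1) → BorelProb X)
  have h1 (l : Fin (n + 1)) : MeasurableSet {ν : Fin (n + 1) → BorelProb X | (ν l).1 F = 1} :=
    BorelProb.measurable_eval_apply l hF (measurableSet_singleton 1)
  have h2 (l : Fin (n + 1)) (c : ι) :
      MeasurableSet {ν : Fin (n + 1) → BorelProb X | 0 < (ν l).1 (D c)} :=
    BorelProb.measurable_eval_apply l (hD c) measurableSet_Ioi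
  have h3 : (fun ν => (⟨n, ν⟩ : LPS X)) ⁻¹' LPS.cautiousBelief F D C =
      ⋃ k : Fin (n + 1), (⋂ l, ⋂ _ : l ≤ k, {ν : Fin (n + 1) → BorelProb X | (ν l).1 F = 1}) ∩
        ⋂ c, ⋂ _ : c ∈ C, ⋃ l, ⋃ _ : l ≤ k, {ν | 0 < (ν l).1 (D c)} := by
    ext ν
    simp [LPS.cautiousBelief]
  rw [h3]
  exact .iUnion fun k => .inter (.iInter fun l => .iInter fun _ => h1 l)
    (.iInter fun c => .iInter fun _ => .iUnion fun l => .iUnion fun _ => h2 l c)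

/-- Transfers cautious belief from types to hierarchies. The index set `C` stays fixed, as the image
measures do not determine which slices are nonempty. -/
theorem LPS.image_mem_cautiousBelief {X Y : Type*} [TopologicalSpace X] [TopologicalSpace Y]
    {ι : Type*} {f : X → Y} (hf : BorelMap f) (ν : LPS X) {F : Set Y} {D : ι → Set Y}
    (C : Set ι) (hF : MeasurableSet[borel Y] F) (hD : ∀ c, MeasurableSet[borel Y] (D c)) :
    ν.image f hf ∈ LPS.cautiousBelief F D C ↔
      ν ∈ LPS.cautiousBelief (f ⁻¹' F) (fun c => f ⁻¹' D c) C := by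
  change (∃ k : Fin (ν.1 + 1), (∀ l ≤ k, ((ν.2 l).image f hf).1 F = 1) ∧
    ∀ c, c ∈ C → ∃ l ≤ k, 0 < ((ν.2 l).image f hf).1 (D c)) ↔ _
  simp only [BorelProb.image_apply hf _ hF, BorelProb.image_apply hf _ (hD _)]
  rfl

/-! ### Cautious rationality as a Borel condition on first-order beliefs -/

theorem measurableSet_lexGE {Ω : Type*} [MeasurableSpace Ω] {n : ℕ} {x y : Fin n → Ω → ℝ}
    (hx : ∀ l, Measurable (x l)) (hy : ∀ l, Measurable (y l)) :
    MeasurableSet {ω | LexGE (fun l => x l ω) (fun l => y l ω)} := by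
  have h : {ω | LexGE (fun l => x l ω) (fun l => y l ω)} =
      (⋂ l, {ω | x l ω = y l ω}) ∪
        ⋃ m, ({ω | y m ω < x m ω} ∩ ⋂ l, ⋂ _ : l < m, {ω | x l ω = y l ω}) := by
    ext ω
    simp [LexGE]
  rw [h]
  exact .union (.iInter fun l => measurableSet_eq_fun (hx l) (hy l)) (.iUnion fun m =>
    .inter (measurableSet_lt (hy m) (hx m))
      (.iInter fun l => .iInter fun _ => measurableSet_eq_fun (hx l) (hy l)))

theorem FiniteGame.measurable_expectedPayoff {I : Type u} [Finite I] [DecidableEq I]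
    (G : FiniteGame.{u, v} I) (i : I) (s : G.S i) {n : ℕ} (l : Fin n) :
    Measurable[borel (Fin n → BorelProb (Others G.S i)), inferInstance]
      (fun ν : Fin n → BorelProb (Others G.S i) => G.expectedPayoff i s (ν l)) := by
  let := borel (Fin n → BorelProb (Others G.S i))
  have := Fintype.ofFinite (Others G.S i)
  simp only [FiniteGame.expectedPayoff, finsum_eq_sum_of_fintype]
  refine Finset.measurable_sum _ fun s' _ => Measurable.const_mul ?_ _
  exact (BorelProb.measurable_eval_apply l
    (@MeasurableSpace.measurableSet_generateFrom _ _ _ (isOpen_discrete {s'}))).ennreal_toReal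

/-- In a discrete space `{x}` is the smallest neighbourhood of `x`, so lying in the support means
having positive mass. -/
theorem LPS.fullSupport_iff {X : Type*} [TopologicalSpace X] [DiscreteTopology X] (ν : LPS X) :
    ν.FullSupport ↔ ∀ x, ∃ l, 0 < (ν.2 l).1 {x} := by
  simp only [LPS.FullSupport, LPS.support, eq_univ_iff_forall, mem_iUnion]
  refine forall_congr' fun x => exists_congr fun l => ?_
  rw [@Measure.mem_support_iff_forall _ _ (borel X)]
  refine ⟨fun h => h _ (by simp), fun h U hU => h.trans_le ?_⟩
  exact (@measure_mono _ _ _ _ (ν.2 l).1 _ _ (singleton_subset_iff.2 (mem_of_mem_nhds hU)))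

theorem LPS.measurableSet_fullSupport {X : Type*} [TopologicalSpace X] [DiscreteTopology X]
    [Finite X] : MeasurableSet[borel (LPS X)] {ν : LPS X | ν.FullSupport} := by
  refine LPS.measurableSet_of_preimage_mk fun n => ?_
  let := borel (Fin (n + 1) → BorelProb X)
  have h : (fun ν => (⟨n, ν⟩ : LPS X)) ⁻¹' {ν : LPS X | ν.FullSupport} =
      ⋂ x, ⋃ l, {ν : Fin (n + 1) → BorelProb X | 0 < (ν l).1 {x}} := by
    ext ν
    simp [LPS.fullSupport_iff]
  rw [h]
  exact .iInter fun x => .iUnion fun l => BorelProb.measurable_eval_apply l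
    (@MeasurableSpace.measurableSet_generateFrom _ _ _ (isOpen_discrete {x})) measurableSet_Ioi

/-- The LPS's on `S₋ᵢ` under which `s` is cautiously rational. -/
def FiniteGame.cautiouslyRational {I : Type u} [DecidableEq I] (G : FiniteGame.{u, v} I) (i : I)
    (s : G.S i) : Set (LPS (Others G.S i)) :=
  {ν | (∀ s' : G.S i, LexGE (fun l => G.expectedPayoff i s (ν.2 l))
    (fun l => G.expectedPayoff i s' (ν.2 l))) ∧ ν.FullSupport}

theorem FiniteGame.measurableSet_cautiouslyRational {I : Type u} [Finite I] [DecidableEq I]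
    (G : FiniteGame.{u, v} I) (i : I) (s : G.S i) :
    MeasurableSet[borel (LPS (Others G.S i))] (G.cautiouslyRational i s) := by
  let := borel (LPS (Others G.S i))
  refine MeasurableSet.inter (s₁ := {ν : LPS (Others G.S i) | ∀ s' : G.S i,
    LexGE (fun l => G.expectedPayoff i s (ν.2 l)) (fun l => G.expectedPayoff i s' (ν.2 l))}) ?_
    LPS.measurableSet_fullSupport
  rw [ofPred_forall]
  refine .iInter fun s' => LPS.measurableSet_of_preimage_mk fun n => ?_
  let := borel (Fin (n + 1) → BorelProb (Others G.S i))
  exact measurableSet_lexGE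
    (x := fun l (ν : Fin (n + 1) → BorelProb (Others G.S i)) => G.expectedPayoff i s (ν l))
    (y := fun l ν => G.expectedPayoff i s' (ν l))
    (G.measurable_expectedPayoff i s) (G.measurable_expectedPayoff i s')

/-! ### Strategies and events in the hierarchy spaces -/

/-- The projection of a hierarchy space to `S₋ᵢ`. -/
def hierarchySpace.strategies {I : Type u} (G : FiniteGame.{u, v} I) :
    ∀ (n : ℕ) (i : I), C(hierarchySpace G n i, Others G.S i)
  | 0, i => ContinuousMap.id (Others G.S i)
  | n + 1, i => (hierarchySpace.strategies G n i).comp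
      (ContinuousMap.fst (α := hierarchySpace G n i)
        (β := ∀ j : {j : I // j ≠ i}, LPS (hierarchySpace G n j)))

namespace TypeStructure

variable {I : Type u} {G : FiniteGame.{u, v} I}

theorem strategies_rho [Finite I] (𝒯 : TypeStructure.{u, v, w} G) (n : ℕ) (i : I)
    (x : Others G.S i × Others 𝒯.T i) :
    hierarchySpace.strategies G n i ((𝒯.rho n i).1 x) = x.1 := by
  induction n with
  | zero => rfl
  | succ n ih => exact ih

/-- Coherence: dropping the last coordinate of `rho (n + 1)` gives `rho n`, so each belief
determines those of lower order. -/
theorem image_fst_hierarchy [Finite I] (𝒯 : TypeStructure.{u, v, w} G) (n : ℕ) (i : I)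
    (t : 𝒯.T i) :
    LPS.image (X := hierarchySpace G n i × ∀ j : {j : I // j ≠ i}, LPS (hierarchySpace G n j))
      Prod.fst continuous_fst.borelMap (𝒯.hierarchy (n + 1) i t) = 𝒯.hierarchy n i t :=
  LPS.image_image continuous_fst.borelMap (𝒯.rho (n + 1) i).2 _

/-- The points of `Xᵢⁿ⁺²` whose strategies and beliefs of order `n + 1` lie in the sets `B`. -/
def profileEvent (n : ℕ) (i : I) (B : ∀ j, G.S j → Set (LPS (hierarchySpace G n j))) :
    Set (hierarchySpace G (n + 1) i) :=
  {x : hierarchySpace G n i × ∀ j : {j : I // j ≠ i}, LPS (hierarchySpace G n j) |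
    ∀ j : {j : I // j ≠ i}, x.2 j ∈ B j (hierarchySpace.strategies G n i x.1 j)}

theorem measurableSet_strategies_preimage (n : ℕ) [Finite I] (i : I) (s : Others G.S i) :
    MeasurableSet[borel (hierarchySpace G n i)] (hierarchySpace.strategies G n i ⁻¹' {s}) :=
  MeasurableSpace.measurableSet_generateFrom
    ((isOpen_discrete {s}).preimage (hierarchySpace.strategies G n i).continuous)

theorem measurableSet_profileEvent [Finite I] (n : ℕ) (i : I)
    {B : ∀ j, G.S j → Set (LPS (hierarchySpace G n j))}
    (hB : ∀ j s, MeasurableSet[borel (LPS (hierarchySpace G n j))] (B j s)) :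
    MeasurableSet[borel (hierarchySpace G (n + 1) i)] (profileEvent n i B) := by
  let := borel (hierarchySpace G (n + 1) i)
  -- The sets `B j` vary with the strategy, so the event is cut along the finitely many profiles
  -- `s`; on each slice they are constant.
  have h : profileEvent n i B = ⋃ s : Others G.S i,
      hierarchySpace.strategies G (n + 1) i ⁻¹' {s} ∩
        ⋂ j, (fun x : hierarchySpace G n i × ∀ j : {j : I // j ≠ i},
          LPS (hierarchySpace G n j) => x.2 j) ⁻¹' B j (s j) := by
    ext x
    simp only [mem_iUnion, mem_inter_iff, mem_preimage, mem_singleton_iff, mem_iInter,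
      exists_eq_left']
    rfl
  rw [h]
  refine .iUnion fun s => .inter (measurableSet_strategies_preimage (n + 1) i s)
    (.iInter fun j => ?_)
  exact ((continuous_apply j).comp continuous_snd).borelMap (hB j (s j))

/-! ### Membership in `R` read off from the hierarchy -/

theorem mem_R_add_two [DecidableEq I] [Finite I] (𝒯 : TypeStructure.{u, v, w} G) (n : ℕ) (i : I)
    {B : ∀ j, G.S j → Set (LPS (hierarchySpace G n j))}
    (hB : ∀ j s, MeasurableSet[borel (LPS (hierarchySpace G n j))] (B j s))
    (hR : ∀ j s t, (s, t) ∈ 𝒯.R (n + 1) j ↔ 𝒯.hierarchy n j t ∈ B j s) (s : G.S i) (t : 𝒯.T i) :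
    (s, t) ∈ 𝒯.R (n + 2) i ↔ 𝒯.hierarchy n i t ∈ B i s ∧
      𝒯.hierarchy (n + 1) i t ∈ LPS.cautiousBelief (profileEvent n i B)
        (fun s' => profileEvent n i B ∩ hierarchySpace.strategies G (n + 1) i ⁻¹' {s'})
        {s' | ∀ j : {j : I // j ≠ i}, s' j ∈ Prod.fst '' 𝒯.R (n + 1) j} := by
  have hF := measurableSet_profileEvent n i hB
  have hD (s' : Others G.S i) : MeasurableSet[borel (hierarchySpace G (n + 1) i)]
      (profileEvent n i B ∩ hierarchySpace.strategies G (n + 1) i ⁻¹' {s'}) := by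
    let := borel (hierarchySpace G (n + 1) i)
    exact hF.inter (measurableSet_strategies_preimage (n + 1) i s')
  have hE : {q : Others G.S i × Others 𝒯.T i | ∀ j : {j : I // j ≠ i},
      (q.1 j, q.2 j) ∈ 𝒯.R (n + 1) j} = (𝒯.rho (n + 1) i).1 ⁻¹' profileEvent n i B := by
    ext q
    refine forall_congr' fun j : {j : I // j ≠ i} => (hR _ _ _).trans ?_
    rw [← 𝒯.strategies_rho n i q]
    rfl
  have hC (s' : Others G.S i) : (𝒯.rho (n + 1) i).1 ⁻¹'
      (profileEvent n i B ∩ hierarchySpace.strategies G (n + 1) i ⁻¹' {s'}) =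
      {q : Others G.S i × Others 𝒯.T i | ∀ j : {j : I // j ≠ i},
        (q.1 j, q.2 j) ∈ 𝒯.R (n + 1) j} ∩ {s'} ×ˢ univ := by
    rw [hE]
    ext q
    simp [strategies_rho]
  have hne (s' : Others G.S i) : ({q : Others G.S i × Others 𝒯.T i | ∀ j : {j : I // j ≠ i},
        (q.1 j, q.2 j) ∈ 𝒯.R (n + 1) j} ∩ {s'} ×ˢ univ).Nonempty ↔
      ∀ j : {j : I // j ≠ i}, s' j ∈ Prod.fst '' 𝒯.R (n + 1) j := by
    constructor
    · rintro ⟨⟨a, b⟩, hq, ha, -⟩ j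
      obtain rfl : a = s' := ha
      exact ⟨_, hq j, rfl⟩
    -- The event is a product over opponents, so witnessing types chosen separately for each `j`
    -- combine into one point of the slice.
    · intro h
      choose p hp hps using h
      obtain rfl : (fun j => (p j).1) = s' := funext hps
      exact ⟨(_, fun j => (p j).2), hp, rfl, trivial⟩
  rw [show 𝒯.hierarchy (n + 1) i t = (𝒯.β i t).image _ (𝒯.rho (n + 1) i).2 from rfl,
    LPS.image_mem_cautiousBelief _ _ _ hF hD]
  simp only [hC]
  rw [← hE, ← hR]
  refine and_congr Iff.rfl (exists_congr fun k => and_congr Iff.rfl (forall_congr' fun s' => ?_))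
  rw [hne]
  rfl

/-- If two type structures have the same strategy projections of `R` up to level `n`, then
membership in `R (n + 1)` is one and the same Borel condition on beliefs of order `n + 1`. -/
theorem exists_measurableSet_mem_R_iff [DecidableEq I] [Finite I]
    (𝒯 : TypeStructure.{u, v, w} G) (𝒯' : TypeStructure.{u, v, w'} G) (n : ℕ)
    (hb : ∀ k ≤ n, ∀ j : I, Prod.fst '' 𝒯.R k j = Prod.fst '' 𝒯'.R k j) (i : I) (s : G.S i) :
    ∃ B : Set (LPS (hierarchySpace G n i)), MeasurableSet[borel (LPS (hierarchySpace G n i))] B ∧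
      (∀ t, (s, t) ∈ 𝒯.R (n + 1) i ↔ 𝒯.hierarchy n i t ∈ B) ∧
      ∀ t, (s, t) ∈ 𝒯'.R (n + 1) i ↔ 𝒯'.hierarchy n i t ∈ B := by
  induction n generalizing i with
  | zero =>
    -- `rho 0` is the projection to `S₋ᵢ`, so `hierarchy 0` is `margS` by definition.
    exact ⟨G.cautiouslyRational i s, G.measurableSet_cautiouslyRational i s, fun _ => Iff.rfl,
      fun _ => Iff.rfl⟩
  | succ n ih =>
    choose B hB hR hR' using ih fun k hk => hb k (hk.trans n.le_succ)
    let C : Set (Others G.S i) := {s' | ∀ j : {j : I // j ≠ i}, s' j ∈ Prod.fst '' 𝒯.R (n + 1) j}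
    -- Equality of the strategy projections enters here: both structures must charge the same
    -- slices.
    have hC : C = {s' | ∀ j : {j : I // j ≠ i}, s' j ∈ Prod.fst '' 𝒯'.R (n + 1) j} := by
      ext s'
      exact forall_congr' fun j => by rw [hb (n + 1) le_rfl j]
    let := borel (LPS (hierarchySpace G (n + 1) i))
    let := borel (hierarchySpace G (n + 1) i)
    refine ⟨LPS.image (X := hierarchySpace G n i × ∀ j : {j : I // j ≠ i},
        LPS (hierarchySpace G n j)) Prod.fst continuous_fst.borelMap ⁻¹' B i s ∩
      LPS.cautiousBelief (profileEvent n i B) (fun s' => profileEvent n i B ∩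
        hierarchySpace.strategies G (n + 1) i ⁻¹' {s'}) C, ?_, fun t => ?_, fun t => ?_⟩
    · refine .inter (LPS.borelMap_image _ _ (hB i s)) ?_
      have hF := measurableSet_profileEvent n i hB
      exact LPS.measurableSet_cautiousBelief C hF fun s' =>
        hF.inter (measurableSet_strategies_preimage (n + 1) i s')
    · rw [𝒯.mem_R_add_two n i hB hR, ← 𝒯.image_fst_hierarchy n i t]
      rfl
    · rw [𝒯'.mem_R_add_two n i hB hR', ← 𝒯'.image_fst_hierarchy n i t, hC]
      rfl

end TypeStructure

/-- The index is shifted by one: `hierarchy m` is the belief of order `m + 1`, matched with `R (m +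
1)`, and the projections are compared at levels `0, …, m`. -/
theorem lemma2 {I : Type u} [Fintype I] [DecidableEq I] (hI : 2 ≤ Fintype.card I)
    (G : FiniteGame.{u, v} I) (𝒯 : TypeStructure.{u, v, w} G) (𝒯' : TypeStructure.{u, v, w'} G)
    (m : ℕ) (i : I) (t : 𝒯.T i) (t' : 𝒯'.T i)
    (ha : 𝒯.hierarchy m i t = 𝒯'.hierarchy m i t')
    (hb : ∀ k ≤ m, ∀ j : I, Prod.fst '' 𝒯.R k j = Prod.fst '' 𝒯'.R k j) :
    ∀ s : G.S i, (s, t) ∈ 𝒯.R (m + 1) i → (s, t') ∈ 𝒯'.R (m + 1) i := by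
  intro s hs
  obtain ⟨B, -, hR, hR'⟩ := 𝒯.exists_measurableSet_mem_R_iff 𝒯' m hb i s
  rw [hR', ← ha]
  exact (hR t).1 hs
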